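/- Conventions. For linear orders $P,Q$ of types $\varphi,\tau$, write $\varphi\le\tau$ if $P$ is isomorphic to a suborder of $Q$. Let $\kappa$ be an infinite cardinal. A linear order $P$ is $\kappa$-dense if $|P|>1$ and, for all $a<b$ in $P$, the open interval $(a,b)_P$ has at least $\kappa$ elements; an order type is $\kappa$-dense if the linear orders of that type are. A linear order type $\varphi$ is $\kappa$-scattered if there is no $\kappa$-dense order type $\tau$ with $\tau\le\varphi$. For linear order types $\varphi,\psi$ and cardinals $\nu,\kappa$, the relation $\psi\longrightarrow[\varphi]^1_{\nu,\kappa}$ means: whenever $P$ is a linear order of type $\psi$ and $f:[P]^1\to\nu$ is a colouring of the one-element subsets of $P$ (equivalently, of the elements of $P$), there are a set $A\subseteq\nu$ with $|A|\le\kappa$ and a suborder $Q\subseteq P$ of type $\varphi$ such that $f(\{q\})\in A$ for all $q\in Q$. Theorem. Suppose $\kappa$ is an infinite cardinal with $\kappa^{<\kappa}=\kappa$, $\varphi$ is a $\kappa$-scattered linear order type, and $\nu$ is a cardinal. Then there is a $\kappa$-scattered linear order type $\psi$ such that $\psi\longrightarrow[\varphi]^1_{\nu,\kappa}$. -/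

import Mathlib

open Cardinal

universe u

/-- `P` is `κ`-dense: it has more than one element, and between any two distinct elements of `P`
there are at least `κ` elements. -/
structure IsCardDense (κ : Cardinal.{u}) (P : Type u) [LinearOrder P] : Prop where
  one_lt_card : 1 < #P
  le_card_Ioo : ∀ a b : P, a < b → κ ≤ #(Set.Ioo a b)

theorem IsCardDense.of_orderIso {κ : Cardinal.{u}} {P Q : Type u} [LinearOrder P] [LinearOrder Q]
    (e : P ≃o Q) (h : IsCardDense κ P) : IsCardDense κ Q where
  one_lt_card := by
    rw [← Cardinal.mk_congr e.toEquiv]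
    exact h.one_lt_card
  le_card_Ioo a b hab := by
    have hlt : e.symm a < e.symm b := e.symm.lt_iff_lt.2 hab
    refine (h.le_card_Ioo _ _ hlt).trans (Cardinal.mk_le_of_injective
      (f := fun c => (⟨e c.1, ?_, ?_⟩ : Set.Ioo a b)) ?_)
    · simpa using e.lt_iff_lt.2 c.2.1
    · simpa using e.lt_iff_lt.2 c.2.2
    · intro c d hcd
      exact Subtype.ext (e.injective (congrArg Subtype.val hcd))

namespace OrderType

/-- An order type is `κ`-dense if its linear orders are. -/
def CardDense (κ : Cardinal.{u}) (φ : OrderType.{u}) : Prop :=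
  IsCardDense κ φ.ToType

/-- `κ`-density of an order type can be tested on any linear order of that type. -/
theorem cardDense_type_iff (κ : Cardinal.{u}) (P : Type u) [LinearOrder P] :
    CardDense κ (type P) ↔ IsCardDense κ P := by
  obtain ⟨e⟩ := type_eq_type.1 (type_toType (type P))
  exact ⟨fun h => IsCardDense.of_orderIso e h, fun h => IsCardDense.of_orderIso e.symm h⟩

/-- An order type `φ` is `κ`-scattered if no `κ`-dense order type `τ` satisfies `τ ≤ φ`
(that is, embeds into `φ`). -/
def CardScattered (κ : Cardinal.{u}) (φ : OrderType.{u}) : Prop :=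
  ¬ ∃ τ : OrderType.{u}, CardDense κ τ ∧ τ ≤ φ

/-- The square-bracket relation `ψ ⟶ [φ]ⁿ_{ν, <μ}`: for every linear order `P` of type `ψ` and every
colouring of the `n`-element subsets of `P` with `ν` colours, there are a set `A` of fewer than `μ`
colours and a suborder `Q` of `P` of type `φ`, all of whose `n`-element subsets get colours
in `A`. -/
def SquareBracketLT (ψ φ : OrderType.{u}) (n : ℕ) (ν μ : Cardinal.{u}) : Prop :=
  ∀ (P : Type u) [LinearOrder P], type P = ψ →
    ∀ (C : Type u), #C = ν → ∀ f : Set.powersetCard P n → C,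
      ∃ (A : Set C) (Q : Set P), #A < μ ∧ type Q = φ ∧
        ∀ s : Set.powersetCard P n, (s.1 : Set P) ⊆ Q → f s ∈ A

/-- The square-bracket relation `ψ ⟶ [φ]ⁿ_{ν, κ}`, which is `ψ ⟶ [φ]ⁿ_{ν, <κ⁺}`: some copy of `φ`
receives at most `κ` colours. -/
def SquareBracket (ψ φ : OrderType.{u}) (n : ℕ) (ν κ : Cardinal.{u}) : Prop :=
  SquareBracketLT ψ φ n ν (Order.succ κ)

end OrderType

/-! Take words of letters (sign, ordinal, index in `E`) with strictly descending ordinals, ordered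
lexicographically. The first letter presents them as a sum along an ordinal or a reversed ordinal,
and then along `E`. If `E` is `κ`-scattered, so are the words below any `ρ` (`Desc.scatteredOn`). If
`E` embeds all orders smaller than `κ`, every `κ`-scattered order embeds into such words, as in
Hausdorff's theorem (`ScatteredOn.representable`). The hypothesis `κ ^< κ = κ` provides an `E` of
size at most `κ` with both properties (`exists_scattered_universal`).

Given `α` and a set of colours, `exists_realizes` finds `ρ` such that every colouring of the words
below `ρ` has a copy of the words below `α` on which the colour depends only on the signs and
indices, not on the ordinals. There are at most `κ` finite sequences of signs and indices, so at
most `κ` colours remain, however many were allowed. -/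

/-! ### Scattered subsets of linear orders -/

/-- A subset `S` of a linear order contains no copy of a `κ`-dense linear order. -/
def ScatteredOn {X : Type*} [LinearOrder X] (κ : Cardinal.{u}) (S : Set X) : Prop :=
  ∀ (D : Type u) [LinearOrder D], IsCardDense κ D → ∀ f : D → X, StrictMono f → ¬ ∀ d, f d ∈ S

namespace ScatteredOn

variable {X Y : Type*} [LinearOrder X] [LinearOrder Y] {κ : Cardinal.{u}} {S T : Set X}

theorem mono (hS : ScatteredOn κ S) (h : T ⊆ S) : ScatteredOn κ T :=
  fun D _ hD f hf hm => hS D hD f hf fun d => h (hm d)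

theorem of_map {U : Set Y} (hU : ScatteredOn κ U) (m : X → Y) (hm : StrictMonoOn m S)
    (hmaps : ∀ x ∈ S, m x ∈ U) : ScatteredOn κ S :=
  fun D _ hD f hf hfS => hU D hD (m ∘ f) (fun _ _ h => hm (hfS _) (hfS _) (hf h))
    fun d => hmaps _ (hfS d)

end ScatteredOn

theorem IsCardDense.Icc {κ : Cardinal.{u}} {D : Type u} [LinearOrder D] (h : IsCardDense κ D)
    {x y : D} (hxy : x < y) : IsCardDense κ (Set.Icc x y) where
  one_lt_card := by
    rw [Cardinal.one_lt_iff_nontrivial]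
    exact ⟨⟨x, le_rfl, hxy.le⟩, ⟨y, hxy.le, le_rfl⟩, fun h => hxy.ne (congrArg Subtype.val h)⟩
  le_card_Ioo a b hab := by
    refine (h.le_card_Ioo a.1 b.1 hab).trans (Cardinal.mk_le_of_injective
      (f := fun c => (⟨⟨c.1, a.2.1.trans c.2.1.le, c.2.2.le.trans b.2.2⟩, c.2.1, c.2.2⟩ :
        Set.Ioo a b)) ?_)
    intro c d hcd
    exact Subtype.ext (congrArg (fun z => z.1.1) hcd)

namespace ScatteredOn

variable {X Y : Type*} [LinearOrder X] [LinearOrder Y] {κ : Cardinal.{u}} {S T : Set X}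

/-- A dense copy on which `m` is injective is carried into `U`. Otherwise `m` identifies two of its
points, and the closed interval between them is a dense copy inside one fibre. -/
theorem of_fiber {U : Set Y} (hU : ScatteredOn κ U) (m : X → Y) (hm : MonotoneOn m S)
    (hmaps : ∀ x ∈ S, m x ∈ U) (hfib : ∀ y, ScatteredOn κ {x ∈ S | m x = y}) :
    ScatteredOn κ S := by
  intro D _ hD f hf hfS
  have hmf : Monotone (m ∘ f) := fun _ _ h => hm (hfS _) (hfS _) (hf.monotone h)
  by_cases hinj : Function.Injective (m ∘ f)
  · exact hU D hD _ (hmf.strictMono_of_injective hinj) fun d => hmaps _ (hfS d)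
  · obtain ⟨x, y, hxy, hne⟩ : ∃ x y, m (f x) = m (f y) ∧ x < y := by
      simp only [Function.Injective, not_forall] at hinj
      obtain ⟨x, y, h, hne⟩ := hinj
      rcases lt_or_gt_of_ne hne with hlt | hlt
      · exact ⟨x, y, h, hlt⟩
      · exact ⟨y, x, h.symm, hlt⟩
    refine hfib (m (f x)) _ (hD.Icc hne) (fun d => f d.1) (fun _ _ h => hf h) fun d =>
      ⟨hfS _, le_antisymm ?_ (hmf d.2.1)⟩
    exact (hmf d.2.2).trans hxy.ge

theorem of_card_lt {S : Set X} (hS : Cardinal.lift.{u} #S < Cardinal.lift κ) :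
    ScatteredOn κ S := by
  intro D _ hD f hf hfS
  have : Nontrivial D := Cardinal.one_lt_iff_nontrivial.1 hD.one_lt_card
  obtain ⟨a, b, hab⟩ := exists_pair_lt D
  have h1 := (hD.le_card_Ioo a b hab).trans (Cardinal.mk_set_le _)
  have h2 : Cardinal.lift #D ≤ Cardinal.lift.{u} #S :=
    Cardinal.lift_mk_le_lift_mk_of_injective (f := fun d => (⟨f d, hfS d⟩ : S))
      fun a b h => hf.injective (congrArg Subtype.val h)
  exact absurd hS (not_lt.2 ((Cardinal.lift_le.2 h1).trans h2))

theorem of_finite (hκ : ℵ₀ ≤ κ) {S : Set X} (hS : S.Finite) : ScatteredOn κ S := by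
  refine of_card_lt (lt_of_lt_of_le ?_ (Cardinal.lift_le.2 hκ))
  have := hS.to_subtype
  simp [Cardinal.lift_lt_aleph0]

theorem of_wellFoundedLT (hκ : ℵ₀ ≤ κ) [WellFoundedLT X] (S : Set X) : ScatteredOn κ S := by
  intro D _ hD f hf hfS
  have : Nontrivial D := Cardinal.one_lt_iff_nontrivial.1 hD.one_lt_card
  have wf : WellFounded ((· < ·) : D → D → Prop) :=
    Subrelation.wf (r := InvImage (· < ·) f) (fun h => hf h) (InvImage.wf f wellFounded_lt)
  obtain ⟨a, b, hab⟩ := exists_pair_lt D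
  obtain ⟨c, hac, hc⟩ := wf.has_min (Set.Ioi a) ⟨b, hab⟩
  have h1 := hD.le_card_Ioo a c hac
  have : Set.Ioo a c = ∅ := by
    ext x; simp only [Set.mem_Ioo, Set.mem_empty_iff_false, iff_false]
    exact fun h => hc x h.1 h.2
  rw [this] at h1
  rw [Cardinal.mk_eq_zero] at h1
  exact not_lt_of_ge (hκ.trans h1) Cardinal.aleph0_pos

theorem of_wellFoundedGT (hκ : ℵ₀ ≤ κ) [WellFoundedGT X] (S : Set X) : ScatteredOn κ S := by
  intro D _ hD f hf hfS
  have : Nontrivial D := Cardinal.one_lt_iff_nontrivial.1 hD.one_lt_card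
  have wf : WellFounded ((· > ·) : D → D → Prop) :=
    Subrelation.wf (r := InvImage (· > ·) f) (fun h => hf h) (InvImage.wf f wellFounded_gt)
  obtain ⟨a, b, hab⟩ := exists_pair_lt D
  obtain ⟨c, hcb, hc⟩ := wf.has_min (Set.Iio b) ⟨a, hab⟩
  have h1 := hD.le_card_Ioo c b hcb
  have : Set.Ioo c b = ∅ := by
    ext x; simp only [Set.mem_Ioo, Set.mem_empty_iff_false, iff_false]
    exact fun h => hc x h.2 h.1
  rw [this] at h1
  rw [Cardinal.mk_eq_zero] at h1
  exact not_lt_of_ge (hκ.trans h1) Cardinal.aleph0_pos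

end ScatteredOn

theorem OrderType.cardScattered_type_iff (κ : Cardinal.{u}) (P : Type u) [LinearOrder P] :
    CardScattered κ (type P) ↔ ScatteredOn κ (Set.univ : Set P) := by
  constructor
  · intro h D _ hD f hf _
    exact h ⟨type D, (cardDense_type_iff κ D).2 hD,
      type_le_type (OrderEmbedding.ofStrictMono f hf)⟩
  · rintro h ⟨τ, hτ, hle⟩
    rw [← type_toType τ, type_le_type_iff] at hle
    obtain ⟨e⟩ := hle
    exact h _ hτ e e.strictMono fun _ => Set.mem_univ _

/-! ### Descending words -/

/-- Signed ordinals: the negative copy is reversed and lies below the positive copy. -/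
def signKey (s : Bool) (o : Ordinal.{u}) : Ordinal.{u}ᵒᵈ ⊕ₗ Ordinal.{u} :=
  match s with
  | false => toLex (Sum.inl (OrderDual.toDual o))
  | true => toLex (Sum.inr o)

/-- A letter: a signed ordinal together with an index from `E`. -/
@[ext]
structure Letter (E : Type u) where
  /-- the sign -/
  sign : Bool
  /-- the ordinal -/
  rank : Ordinal.{u}
  /-- the index -/
  idx : E

namespace Letter

variable {E : Type u}

theorem signKey_injective {s s' : Bool} {o o' : Ordinal.{u}} (h : signKey s o = signKey s' o') :
    s = s' ∧ o = o' := by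
  cases s <;> cases s' <;> simp_all [signKey]

noncomputable instance [LinearOrder E] : LinearOrder (Letter E) :=
  LinearOrder.lift' (fun a => toLex (signKey a.sign a.rank, a.idx)) (by
    rintro ⟨s, o, e⟩ ⟨s', o', e'⟩ h
    have h := toLex.injective h
    rw [Prod.mk.injEq] at h
    exact Letter.ext (signKey_injective h.1).1 (signKey_injective h.1).2 h.2)

theorem lt_iff [LinearOrder E] {a b : Letter E} : a < b ↔
    signKey a.sign a.rank < signKey b.sign b.rank ∨
      signKey a.sign a.rank = signKey b.sign b.rank ∧ a.idx < b.idx :=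
  Prod.Lex.toLex_lt_toLex

theorem signKey_lt {s s' : Bool} {o o' : Ordinal.{u}} : signKey s o < signKey s' o' ↔
    s < s' ∨ s = s' ∧ ((s = true ∧ o < o') ∨ (s = false ∧ o' < o)) := by
  cases s <;> cases s' <;> simp [signKey]

theorem mk_lt_mk [LinearOrder E] {s s' : Bool} {o o' : Ordinal.{u}} {e e' : E} :
    (⟨s, o, e⟩ : Letter E) < ⟨s', o', e'⟩ ↔
      s < s' ∨ s = s' ∧ (((s = true ∧ o < o') ∨ (s = false ∧ o' < o)) ∨ o = o' ∧ e < e') := by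
  rw [lt_iff, signKey_lt]
  constructor
  · rintro ((h | h) | h)
    · exact .inl h
    · exact .inr ⟨h.1, .inl h.2⟩
    · exact .inr ⟨(signKey_injective h.1).1, .inr ⟨(signKey_injective h.1).2, h.2⟩⟩
  · rintro (h | ⟨rfl, h | ⟨rfl, h⟩⟩)
    · exact .inl (.inl h)
    · exact .inl (.inr ⟨rfl, h⟩)
    · exact .inr ⟨rfl, h⟩

end Letter

/-- The words whose ranks are strictly descending and start below `ρ`. -/
def Desc {E : Type u} : Ordinal.{u} → List (Letter E) → Prop
  | _, [] => True
  | ρ, a :: l => a.rank < ρ ∧ Desc a.rank l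

namespace Desc

variable {E : Type u}

theorem mono {ρ σ : Ordinal.{u}} (h : ρ ≤ σ) {l : List (Letter E)} (hl : Desc ρ l) :
    Desc σ l := by
  cases l with
  | nil => trivial
  | cons a l => exact ⟨hl.1.trans_le h, hl.2⟩

theorem rank_lt {ρ : Ordinal.{u}} {l : List (Letter E)} (hl : Desc ρ l) :
    ∀ a ∈ l, a.rank < ρ := by
  induction l generalizing ρ with
  | nil => simp
  | cons b l ih =>
    intro a ha
    rcases List.mem_cons.1 ha with rfl | ha
    · exact hl.1
    · exact (ih hl.2 a ha).trans hl.1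

/-- All ranks lie below `ρ`, so only a small set of letters occurs. This lets the order of words be
moved into universe `u`. -/
instance small (ρ : Ordinal.{u}) : Small.{u} {l : List (Letter E) | Desc ρ l} := by
  let f : List (Bool × Set.Iio ρ × E) → List (Letter E) :=
    List.map fun x => ⟨x.1, x.2.1.1, x.2.2⟩
  suffices h : {l : List (Letter E) | Desc ρ l} ⊆ Set.range f from small_subset h
  intro l hl
  replace hl := rank_lt hl
  induction l with
  | nil => exact ⟨[], rfl⟩
  | cons a l ih =>
    obtain ⟨l', rfl⟩ := ih fun b hb => hl b (List.mem_cons_of_mem _ hb)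
    exact ⟨(a.sign, ⟨a.rank, hl a List.mem_cons_self⟩, a.idx) :: l', rfl⟩

theorem cons_lt_cons [LinearOrder E] {a b : Letter E} {l m : List (Letter E)} :
    a :: l < b :: m ↔ a < b ∨ a = b ∧ l < m := List.cons_lt_cons_iff

/-- Induction on `ρ`, peeling off the first letter by `of_fiber`: its sign, then its rank
(well-ordered or reversed), then its index in `E`. What is left is the tail, a descending word below
a smaller rank. -/
theorem scatteredOn [LinearOrder E] {κ : Cardinal.{u}} (hκ : ℵ₀ ≤ κ)
    (hE : ScatteredOn κ (Set.univ : Set E)) (ρ : Ordinal.{u}) :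
    ScatteredOn κ {l : List (Letter E) | Desc ρ l} := by
  induction ρ using WellFoundedLT.induction with
  | ind ρ ih =>
  let code : List (Letter E) → ℕ := fun l => match l with
    | [] => 0
    | a :: _ => if a.sign then 2 else 1
  let rk : List (Letter E) → Ordinal.{u} := fun l => match l with
    | [] => 0
    | a :: _ => a.rank
  have tails : ∀ (s : Bool) (o : Ordinal.{u}),
      ScatteredOn κ {l : List (Letter E) | Desc ρ l ∧ ∃ e m, l = ⟨s, o, e⟩ :: m} := by
    intro s o
    by_cases ho : o < ρ
    swap
    · intro D _ hD f hf hfS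
      have : Nontrivial D := Cardinal.one_lt_iff_nontrivial.1 hD.one_lt_card
      obtain ⟨a⟩ := this.to_nonempty
      obtain ⟨h, e, m, hm⟩ := hfS a
      rw [hm] at h
      exact ho h.1
    rcases isEmpty_or_nonempty E with hE0 | ⟨⟨e0⟩⟩
    · refine ScatteredOn.of_finite hκ (Set.finite_empty.subset ?_)
      rintro l ⟨_, e, _⟩
      exact hE0.elim e
    refine ScatteredOn.of_fiber hE (fun l => match l with | [] => e0 | a :: _ => a.idx) ?_
      (fun _ _ => Set.mem_univ _) ?_
    · rintro _ ⟨_, e, m, rfl⟩ _ ⟨_, e', m', rfl⟩ h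
      by_contra hlt
      refine not_lt_of_ge h (cons_lt_cons.2 (.inl (Letter.mk_lt_mk.2 (.inr ⟨rfl, .inr ⟨rfl, ?_⟩⟩))))
      exact not_le.1 hlt
    · intro e
      refine (ih o ho).of_map List.tail ?_ ?_
      · rintro _ ⟨⟨_, e, m, rfl⟩, rfl⟩ _ ⟨⟨_, e', m', rfl⟩, he⟩ h
        simp only at he
        subst he
        simpa [cons_lt_cons] using h
      · rintro _ ⟨⟨h, e, m, rfl⟩, rfl⟩
        exact h.2
  refine ScatteredOn.of_fiber (ScatteredOn.of_wellFoundedLT hκ (Set.univ : Set ℕ)) code ?_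
    (fun _ _ => Set.mem_univ _) ?_
  · rintro l - l' - h
    rcases l with _ | ⟨⟨s, o, e⟩, l⟩
    · exact Nat.zero_le _
    rcases l' with _ | ⟨⟨s', o', e'⟩, l'⟩
    · exact absurd h (by simp)
    · by_contra hlt
      refine not_lt_of_ge h (cons_lt_cons.2 (.inl (Letter.mk_lt_mk.2 (.inl ?_))))
      revert hlt
      cases s <;> cases s' <;> simp [code]
  · intro n
    match n with
    | 0 =>
      refine ScatteredOn.of_finite hκ ((Set.finite_singleton []).subset ?_)
      rintro (_ | ⟨⟨s, o, e⟩, l⟩) ⟨-, h⟩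
      · rfl
      · cases s <;> simp [code] at h
    | 1 =>
      refine ScatteredOn.of_fiber
        (ScatteredOn.of_wellFoundedGT hκ (Set.univ : Set Ordinal.{u}ᵒᵈ))
        (fun l => OrderDual.toDual (rk l)) ?_ (fun _ _ => Set.mem_univ _) ?_
      · rintro (_ | ⟨⟨s, o, e⟩, l⟩) ⟨-, h1⟩ (_ | ⟨⟨s', o', e'⟩, l'⟩) ⟨-, h2⟩ h
        · simp [code] at h1
        · simp [code] at h1
        · simp [code] at h2
        · cases s <;> cases s' <;> simp [code] at h1 h2
          by_contra hlt
          refine not_lt_of_ge h (cons_lt_cons.2 (.inl (Letter.mk_lt_mk.2 (.inr ⟨rfl, .inl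
            (.inr ⟨rfl, ?_⟩)⟩))))
          exact not_le.1 hlt
      · intro o
        refine (tails false (OrderDual.ofDual o)).mono ?_
        rintro (_ | ⟨⟨s, o, e⟩, l⟩) ⟨⟨h, h1⟩, h2⟩
        · simp [code] at h1
        · cases s <;> simp [code] at h1
          exact ⟨h, e, l, by subst h2; rfl⟩
    | 2 =>
      refine ScatteredOn.of_fiber
        (ScatteredOn.of_wellFoundedLT hκ (Set.univ : Set Ordinal.{u}))
        rk ?_ (fun _ _ => Set.mem_univ _) ?_
      · rintro (_ | ⟨⟨s, o, e⟩, l⟩) ⟨-, h1⟩ (_ | ⟨⟨s', o', e'⟩, l'⟩) ⟨-, h2⟩ h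
        · simp [code] at h1
        · simp [code] at h1
        · simp [code] at h2
        · cases s <;> cases s' <;> simp [code] at h1 h2
          by_contra hlt
          refine not_lt_of_ge h (cons_lt_cons.2 (.inl (Letter.mk_lt_mk.2 (.inr ⟨rfl, .inl
            (.inl ⟨rfl, ?_⟩)⟩))))
          exact not_le.1 hlt
      · intro o
        refine (tails true o).mono ?_
        rintro (_ | ⟨⟨s, o, e⟩, l⟩) ⟨⟨h, h1⟩, h2⟩
        · simp [code] at h1
        · cases s <;> simp [code] at h1
          exact ⟨h, e, l, by subst h2; rfl⟩
    | n + 3 =>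
      refine ScatteredOn.of_finite hκ (Set.finite_empty.subset ?_)
      rintro (_ | ⟨⟨s, o, e⟩, l⟩) ⟨-, h⟩
      · simp [code] at h
      · cases s <;> simp [code] at h

end Desc

/-! ### A small universal scattered order -/

theorem LinearOrder.mk_le (α : Type u) : #(LinearOrder α) ≤ (2 ^ #α) ^ #α := by
  have hinj : Function.Injective (fun o : LinearOrder α => ({p | o.le p.1 p.2} : Set (α × α))) := by
    intro o o' h
    refine LinearOrder.ext (fun a b => ?_)
    exact Set.ext_iff.1 h (a, b)
  refine (mk_le_of_injective hinj).trans ?_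
  rw [mk_set, mk_prod, lift_id, power_mul]

/-- A lexicographic sum of small orders along a small well-order. -/
theorem exists_scattered_wellOrdered_sum {κ : Cardinal.{u}} (hκ : ℵ₀ ≤ κ) {J : Type u}
    (hJ : #J ≤ κ) (F : J → Type u) [hF : ∀ j, LinearOrder (F j)] (hFκ : ∀ j, #(F j) < κ) :
    ∃ (E : Type u) (_ : LinearOrder E), #E ≤ κ ∧ ScatteredOn κ (Set.univ : Set E) ∧
      ∀ j, ∃ f : F j → E, StrictMono f := by
  obtain ⟨_, _⟩ := exists_wellFoundedLT J
  refine ⟨Σₗ j, F j, inferInstance, ?_, ?_, ?_⟩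
  · change #(Σ j, F j) ≤ κ
    rw [mk_sigma]
    refine (sum_le_sum _ _ fun j => (hFκ j).le).trans ?_
    rw [sum_const']
    exact (mul_le_mul_left hJ κ).trans (mul_eq_self hκ).le
  · refine ScatteredOn.of_fiber (ScatteredOn.of_wellFoundedLT hκ (Set.univ : Set J))
      (fun x => (ofLex x).1) ?_ (fun _ _ => Set.mem_univ _) ?_
    · rintro x - y - h
      rcases Sigma.Lex.le_def.1 h with h | ⟨h, -⟩
      · exact h.le
      · exact h.le
    · intro j
      refine ScatteredOn.of_card_lt ?_
      rw [lift_lt]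
      refine lt_of_le_of_lt ?_ (hFκ j)
      refine mk_le_of_surjective (f := fun x : F j => ⟨toLex ⟨j, x⟩, Set.mem_univ _, rfl⟩) ?_
      rintro ⟨⟨i, a⟩, -, h⟩
      change i = j at h
      subst h
      exact ⟨a, rfl⟩
  · exact fun j => ⟨fun i => toLex ⟨j, i⟩, fun a b hab => Sigma.Lex.lt_def.2 (.inr ⟨rfl, hab⟩)⟩

/-- If `κ ^< κ = κ`, some `κ`-scattered linear order of size at most `κ` embeds every linear order
of size less than `κ`. -/
theorem exists_scattered_universal {κ : Cardinal.{u}} (hκ : ℵ₀ ≤ κ) (hpow : κ ^< κ = κ) :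
    ∃ (E : Type u) (_ : LinearOrder E), #E ≤ κ ∧ ScatteredOn κ (Set.univ : Set E) ∧
      ∀ (I : Type u) [LinearOrder I], #I < κ → ∃ f : I → E, StrictMono f := by
  have hIio : ∀ x : κ.ord.ToType, #(Set.Iio x) < κ := fun x => by
    simpa using mk_Iio_lt x
  have hlt : ∀ μ < κ, κ ^ μ ≤ κ := fun μ hμ => (le_powerlt κ hμ).trans hpow.le
  have hκ2 : 2 ≤ κ := (Cardinal.natCast_lt_aleph0 (n := 2)).le.trans hκ
  -- Every order of size less than `κ` is copied onto a proper initial segment of `κ`, and `κ ^< κ =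
  -- κ` leaves at most `κ` orders on these segments. `E` is their sum along a well-order.
  have hcard : ∀ x : κ.ord.ToType, #(LinearOrder (Set.Iio x)) ≤ κ := fun x =>
    (LinearOrder.mk_le _).trans <| (power_le_power_right
      ((power_le_power_right hκ2).trans (hlt _ (hIio x)))).trans (hlt _ (hIio x))
  have hJκ : #(Σ x : κ.ord.ToType, LinearOrder (Set.Iio x)) ≤ κ := by
    rw [mk_sigma]
    refine (sum_le_sum _ _ hcard).trans ?_
    rw [sum_const', mk_ord_toType]
    exact (mul_eq_self hκ).le
  obtain ⟨E, oE, hE, hsc, hemb⟩ := exists_scattered_wellOrdered_sum hκ hJκ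
    (fun j => Set.Iio j.1) (hF := fun j => j.2) fun j => hIio j.1
  refine ⟨E, oE, hE, hsc, fun I _ hI => ?_⟩
  have hI' : (#I).ord < κ.ord := ord_lt_ord.2 hI
  let x : κ.ord.ToType := Ordinal.ToType.mk ⟨_, hI'⟩
  have hx : #(Set.Iio x) = #I := by
    have h := Ordinal.card_typein (r := ((· < ·) : κ.ord.ToType → κ.ord.ToType → Prop)) x
    rw [show Ordinal.typein ((· < ·) : κ.ord.ToType → κ.ord.ToType → Prop) x = (#I).ord from
      Ordinal.typein_enum _ _, card_ord] at h
    exact h.symm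
  obtain ⟨e⟩ := Cardinal.eq.1 hx
  obtain ⟨f, hf⟩ := hemb ⟨x, LinearOrder.lift' e e.injective⟩
  refine ⟨fun i => f (e.symm i), fun a b hab => hf ?_⟩
  change e (e.symm a) < e (e.symm b)
  simpa using hab

/-! ### The partition theorem for descending words -/

/-- For every partition of the ordinals into a small number of parts, and every `θ`, some part has
a subset of type `θ`, and this happens below a bound that does not depend on the partition. -/
theorem exists_ordinal_pigeonhole (V : Type*) [Small.{u} V] (θ : Ordinal.{u}) :
    ∃ ρ : Ordinal.{u}, ∀ f : Ordinal.{u} → V, ∃ (v : V) (b : Ordinal.{u} → Ordinal.{u}),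
      StrictMonoOn b (Set.Iio θ) ∧ ∀ β < θ, b β < ρ ∧ f (b β) = v := by
  -- The successor of `μ` is regular and exceeds both the number of parts and `θ.card`, so some part
  -- has full size and hence order type at least `θ`.
  let μ : Cardinal.{u} := max ℵ₀ (max #(Shrink.{u} V) θ.card)
  refine ⟨(Order.succ μ).ord, fun f => ?_⟩
  let F : (Order.succ μ).ord.ToType → Shrink.{u} V := fun x =>
    equivShrink V (f (Ordinal.ToType.mk.symm x).1)
  have hreg : (Order.succ μ).IsRegular := isRegular_succ (le_max_left _ _)
  obtain ⟨a, ha⟩ := infinite_pigeonhole_card F (Order.succ μ) (by simp)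
    hreg.aleph0_le (by
      rw [hreg.cof_ord]
      exact Order.lt_succ_of_le ((le_max_left _ _).trans (le_max_right _ _)))
  have hθ : θ ≤ Ordinal.type (α := F ⁻¹' {a}) (· < ·) := by
    refine le_of_lt (lt_of_not_ge fun h => not_lt_of_ge (Ordinal.card_le_card h) ?_)
    rw [Ordinal.card_type]
    refine lt_of_lt_of_le (Order.lt_succ_of_le ?_) ha
    exact (le_max_right _ _).trans (le_max_right _ _)
  rw [← Ordinal.type_toType θ, Ordinal.type_le_iff'] at hθ
  obtain ⟨g⟩ := hθ
  refine ⟨(equivShrink V).symm a, fun β => if h : β ∈ Set.Iio θ then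
    (Ordinal.ToType.mk.symm (g (Ordinal.ToType.mk ⟨β, h⟩)).1).1 else 0, ?_, ?_⟩
  · intro β hβ γ hγ h
    beta_reduce
    rw [dif_pos hβ, dif_pos hγ]
    refine Ordinal.ToType.mk.symm.strictMono (g.map_rel_iff.2 ?_)
    exact Ordinal.ToType.mk.strictMono h
  · intro β (hβ : β ∈ Set.Iio θ)
    beta_reduce
    rw [dif_pos hβ]
    refine ⟨(Ordinal.ToType.mk.symm (g (Ordinal.ToType.mk ⟨β, hβ⟩)).1).2, ?_⟩
    have h : F (g (Ordinal.ToType.mk ⟨β, hβ⟩)).1 = a := (g (Ordinal.ToType.mk ⟨β, hβ⟩)).2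
    exact ((equivShrink V).eq_symm_apply).2 h

/-- The word obtained from a sequence of letters by forgetting the ranks. -/
def signWord {E : Type u} (l : List (Letter E)) : List (Bool × E) :=
  l.map fun a => (a.sign, a.idx)

/-- The descending words below `β` embed into those below `ρ` so that the colour of an image is
prescribed by the sign word of the preimage. -/
def Realizes {E C : Type u} [LinearOrder E] (g : List (Bool × E) → C) (β ρ : Ordinal.{u})
    (c : List (Letter E) → C) : Prop :=
  ∃ j : List (Letter E) → List (Letter E), StrictMonoOn j {l | Desc β l} ∧
    ∀ l, Desc β l → Desc ρ (j l) ∧ c (j l) = g (signWord l)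

section Partition

variable {E C : Type u} [LinearOrder E]

/-- A head of rank `β` is moved to rank `b β` with its sign and index kept, and the tail is mapped
by the embedding for that child. -/
theorem Realizes.of_children {g : List (Bool × E) → C} {α ρ : Ordinal.{u}}
    {c : List (Letter E) → C} (h0 : c [] = g []) (b : Ordinal.{u} → Ordinal.{u})
    (hb : StrictMonoOn b (Set.Iio α)) (hbρ : ∀ β < α, b β < ρ)
    (hr : ∀ β < α, ∀ s e, Realizes (fun w => g ((s, e) :: w)) β (b β)
      (fun l => c (⟨s, b β, e⟩ :: l))) : Realizes g α ρ c := by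
  choose! j hj hjc using hr
  refine ⟨fun l => match l with
    | [] => []
    | a :: l => ⟨a.sign, b a.rank, a.idx⟩ :: j a.rank a.sign a.idx l, ?_, ?_⟩
  · rintro (_ | ⟨⟨s, o, e⟩, l⟩) hl (_ | ⟨⟨s', o', e'⟩, l'⟩) hl' h
    · exact absurd h (lt_irrefl _)
    · exact List.nil_lt_cons _ _
    · exact absurd h (List.not_lt_nil _)
    · rcases Desc.cons_lt_cons.1 h with h | ⟨h, hlt⟩
      · refine Desc.cons_lt_cons.2 (.inl (Letter.mk_lt_mk.2 ?_))
        rcases Letter.mk_lt_mk.1 h with hs | ⟨hs, (⟨h1, h2⟩ | ⟨h1, h2⟩) | ⟨rfl, h2⟩⟩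
        · exact .inl hs
        · exact .inr ⟨hs, .inl (.inl ⟨h1, hb hl.1 hl'.1 h2⟩)⟩
        · exact .inr ⟨hs, .inl (.inr ⟨h1, hb hl'.1 hl.1 h2⟩)⟩
        · exact .inr ⟨hs, .inr ⟨rfl, h2⟩⟩
      · obtain ⟨rfl, rfl, rfl⟩ := Letter.mk.injEq .. ▸ h
        exact Desc.cons_lt_cons.2 (.inr ⟨rfl, hj _ hl.1 _ _ hl.2 hl'.2 hlt⟩)
  · rintro (_ | ⟨⟨s, o, e⟩, l⟩) hl
    · exact ⟨trivial, h0⟩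
    · have := hjc o hl.1 s e l hl.2
      exact ⟨⟨hbρ o hl.1, this.1⟩, this.2⟩

/-- The type of a colouring: which colour patterns are realized, up to rank `α`. -/
def colourType (α ρ : Ordinal.{u}) (c : List (Letter E) → C) :
    Set ((List (Bool × E) → C) × Set.Iic α) :=
  {p | Realizes p.1 p.2 ρ c}

/-- A type that occurs at unboundedly many ranks. -/
def Recurrent (α : Ordinal.{u}) (t : Set ((List (Bool × E) → C) × Set.Iic α)) : Prop :=
  ∀ θ : Ordinal.{u}, ∃ ρ, θ ≤ ρ ∧ ∃ c, colourType α ρ c = t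

/-- If every `v` failed at some ordinal, all would fail at the supremum of these ordinals. -/
theorem exists_forall_ordinal {V : Type*} [Small.{u} V] {p : V → Ordinal.{u} → Prop}
    (hp : ∀ v θ θ', θ ≤ θ' → p v θ' → p v θ) (h : ∀ θ, ∃ v, p v θ) : ∃ v, ∀ θ, p v θ := by
  by_contra! hcon
  choose Θ hΘ using hcon
  obtain ⟨v, hv⟩ := h (⨆ v, Θ v)
  exact hΘ v (hp v _ _ (le_ciSup Ordinal.bddAbove_of_small v) hv)

/-- For each `θ`, the ordinal pigeonhole gives `θ` many child ranks sharing one family of types;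
`exists_forall_ordinal` makes the root colour and the family independent of `θ`. -/
theorem Recurrent.exists_children {α : Ordinal.{u}}
    {t : Set ((List (Bool × E) → C) × Set.Iic α)} (ht : Recurrent α t) :
    ∃ nv : C × (Bool × E → Set ((List (Bool × E) → C) × Set.Iic α)), ∀ θ : Ordinal.{u},
      ∃ (ρ : Ordinal.{u}) (c : List (Letter E) → C) (b : Ordinal.{u} → Ordinal.{u}),
        colourType α ρ c = t ∧ c [] = nv.1 ∧ StrictMonoOn b (Set.Iio θ) ∧
        ∀ β < θ, b β < ρ ∧
          ∀ s e, colourType α (b β) (fun l => c (⟨s, b β, e⟩ :: l)) = nv.2 (s, e) := by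
  refine exists_forall_ordinal ?_ ?_
  · rintro nv θ θ' h ⟨ρ, c, b, h1, h2, h3, h4⟩
    exact ⟨ρ, c, b, h1, h2, h3.mono (Set.Iio_subset_Iio h), fun β hβ => h4 β (hβ.trans_le h)⟩
  · intro θ
    obtain ⟨ρ₀, hρ₀⟩ := exists_ordinal_pigeonhole
      (Bool × E → Set ((List (Bool × E) → C) × Set.Iic α)) θ
    obtain ⟨ρ, hρ, c, hc⟩ := ht ρ₀
    obtain ⟨v, b, hb, hbv⟩ := hρ₀ fun β x => colourType α β fun l => c (⟨x.1, β, x.2⟩ :: l)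
    exact ⟨(c [], v), ρ, c, b, hc, rfl, hb, fun β hβ =>
      ⟨(hbv β hβ).1.trans_le hρ, fun s e => congrFun (hbv β hβ).2 (s, e)⟩⟩

theorem le_of_strictMonoOn_Iio {b : Ordinal.{u} → Ordinal.{u}} {θ : Ordinal.{u}}
    (hb : StrictMonoOn b (Set.Iio θ)) : ∀ β < θ, β ≤ b β := by
  intro β
  induction β using WellFoundedLT.induction with
  | ind β ih =>
    intro hβ
    refine le_of_forall_lt fun γ hγ => ?_
    exact (ih γ hγ (hγ.trans hβ)).trans_lt (hb (hγ.trans hβ : γ < θ) hβ hγ)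

/-- Every colouring of sufficiently long descending words contains a copy of the descending words
below `α` in which the colour depends only on the sign word. -/
theorem exists_realizes (α : Ordinal.{u}) :
    ∃ ρ : Ordinal.{u}, ∀ c : List (Letter E) → C, ∃ g, Realizes g α ρ c := by
  choose nv hnv using fun t : {t : Set ((List (Bool × E) → C) × Set.Iic α) // Recurrent α t} =>
    t.2.exists_children
  have hrec : ∀ t x, Recurrent α ((nv t).2 x) := by
    rintro t ⟨s, e⟩ θ
    -- With `θ + 1` children there is one indexed by `θ`, and its rank `b θ` is at least `θ`.
    obtain ⟨ρ, c, b, -, -, hb, h⟩ := hnv t (θ + 1)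
    have hθ : θ < θ + 1 := Order.lt_succ θ
    exact ⟨b θ, le_of_strictMonoOn_Iio hb θ hθ, _, (h θ hθ).2 s e⟩
  let step : {t : Set ((List (Bool × E) → C) × Set.Iic α) // Recurrent α t} → Bool × E →
      {t : Set ((List (Bool × E) → C) × Set.Iic α) // Recurrent α t} :=
    fun t x => ⟨(nv t).2 x, hrec t x⟩
  -- A sign word is read as a walk through recurrent types; its colour is the root colour of the
  -- type reached. Ranks play no role in the walk.
  let g := fun t (w : List (Bool × E)) => (nv (w.foldl step t)).1
  have key : ∀ β ≤ α, ∀ t ρ c, colourType α ρ c = t.1 → Realizes (g t) β ρ c := by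
    intro β
    induction β using WellFoundedLT.induction with
    | ind β ih =>
      intro hβ t ρ c hc
      obtain ⟨ρ', c', b, hc', h0, hb, h⟩ := hnv t β
      have : Realizes (g t) β ρ' c' := .of_children h0 b hb (fun γ hγ => (h γ hγ).1)
        fun γ hγ s e => ih γ hγ (hγ.le.trans hβ) (step t (s, e)) _ _ ((h γ hγ).2 s e)
      -- The pattern was built for the witness `c'`, but the patterns realized are part of the type,
      -- which `c` shares.
      have hmem : (g t, (⟨β, hβ⟩ : Set.Iic α)) ∈ colourType α ρ' c' := this
      rw [hc', ← hc] at hmem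
      exact hmem
  -- If each `ρ` had a bad colouring, some type would occur for these at unboundedly many `ρ`. It
  -- would be recurrent, and `key` would apply.
  by_contra! hcon
  choose c hc using hcon
  obtain ⟨t, ht⟩ : ∃ t, ∀ θ, ∃ ρ, θ ≤ ρ ∧ colourType α ρ (c ρ) = t :=
    exists_forall_ordinal (fun v θ θ' h ⟨ρ, h1, h2⟩ => ⟨ρ, h.trans h1, h2⟩)
      fun θ => ⟨_, θ, le_rfl, rfl⟩
  have htr : Recurrent α t := fun θ => by
    obtain ⟨ρ, h1, h2⟩ := ht θ
    exact ⟨ρ, h1, c ρ, h2⟩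
  obtain ⟨ρ, -, h⟩ := ht 0
  exact hc ρ _ (key α le_rfl ⟨t, htr⟩ ρ (c ρ) h)

end Partition

/-! ### Hausdorff's theorem -/

/-- `S` embeds into the descending words below `ρ`. -/
def RepresentedBelow (E : Type u) [LinearOrder E] {X : Type u} [LinearOrder X] (ρ : Ordinal.{u})
    (S : Set X) : Prop :=
  ∃ f : X → List (Letter E), StrictMonoOn f S ∧ ∀ x ∈ S, Desc ρ (f x)

/-- `S` embeds into the descending words below some ordinal. -/
def Representable (E : Type u) [LinearOrder E] {X : Type u} [LinearOrder X] (S : Set X) : Prop :=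
  ∃ ρ, RepresentedBelow E ρ S

section Representable

variable {E X : Type u} [LinearOrder E] [LinearOrder X] {S T : Set X}

theorem RepresentedBelow.mono {ρ σ : Ordinal.{u}} (h : RepresentedBelow E ρ S) (hρ : ρ ≤ σ)
    (hT : T ⊆ S) : RepresentedBelow E σ T := by
  obtain ⟨f, hf, hfS⟩ := h
  exact ⟨f, hf.mono hT, fun x hx => (hfS x (hT hx)).mono hρ⟩

theorem RepresentedBelow.of_subsingleton (ρ : Ordinal.{u}) (h : S.Subsingleton) :
    RepresentedBelow E ρ S :=
  ⟨fun _ => [], fun _ hx _ hy hxy => absurd (h hx hy) hxy.ne, fun _ _ => trivial⟩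

theorem RepresentedBelow.cons {ρ : Ordinal.{u}} (h : X → Letter E) (hm : MonotoneOn h S)
    (hρ : ∀ x ∈ S, (h x).rank < ρ)
    (hfib : ∀ x ∈ S, RepresentedBelow E (h x).rank {y ∈ S | h y = h x}) :
    RepresentedBelow E ρ S := by
  have hfib' : ∀ a, ∃ f : X → List (Letter E), StrictMonoOn f {y ∈ S | h y = a} ∧
      ∀ x ∈ {y ∈ S | h y = a}, Desc a.rank (f x) := by
    intro a
    by_cases ha : ∃ x ∈ S, h x = a
    · obtain ⟨x, hx, rfl⟩ := ha
      exact hfib x hx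
    · exact RepresentedBelow.of_subsingleton _ fun x hx => absurd ⟨x, hx⟩ ha
  choose f hf hfd using hfib'
  refine ⟨fun x => h x :: f (h x) x, ?_, fun x hx => ⟨hρ x hx, hfd _ x ⟨hx, rfl⟩⟩⟩
  intro x hx y hy hxy
  rcases (hm hx hy hxy.le).lt_or_eq with hlt | heq
  · exact Desc.cons_lt_cons.2 (.inl hlt)
  · refine Desc.cons_lt_cons.2 (.inr ⟨heq, ?_⟩)
    rw [heq]
    exact hf (h y) ⟨hx, heq⟩ ⟨hy, rfl⟩ hxy

namespace Representable

theorem mono (h : Representable E S) (hT : T ⊆ S) : Representable E T := by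
  obtain ⟨ρ, h⟩ := h
  exact ⟨ρ, h.mono le_rfl hT⟩

theorem of_subsingleton (h : S.Subsingleton) : Representable E S :=
  ⟨0, .of_subsingleton 0 h⟩

/-- The head gets rank `μ + m x`, where `μ` bounds the ranks needed by the fibres, so that the tails
stay descending. -/
theorem sum (s : Bool) (m : X → Ordinal.{u}) (i : X → E)
    (hmono : ∀ μ, MonotoneOn (fun x => (⟨s, μ + m x, i x⟩ : Letter E)) S)
    (hfib : ∀ x ∈ S, Representable E {y ∈ S | m y = m x ∧ i y = i x}) : Representable E S := by
  choose! r hr using hfib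
  let μ := ⨆ x, r x
  have hμ : ∀ x, r x ≤ μ := le_ciSup Ordinal.bddAbove_of_small
  refine ⟨μ + (⨆ x, m x) + 1, .cons _ (hmono μ) ?_ ?_⟩
  · intro x _
    refine Order.lt_succ_of_le ?_
    have : m x ≤ ⨆ x, m x := le_ciSup Ordinal.bddAbove_of_small x
    exact add_le_add le_rfl this
  · intro x hx
    refine (hr x hx).mono ((hμ x).trans le_self_add) ?_
    rintro y ⟨hy, h⟩
    rw [Letter.mk.injEq] at h
    exact ⟨hy, add_left_cancel h.2.1, h.2.2⟩

theorem sum_index (i : X → E) (hi : MonotoneOn i S)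
    (hfib : ∀ x ∈ S, Representable E {y ∈ S | i y = i x}) : Representable E S := by
  refine sum true (fun _ => 0) i ?_ fun x hx => (hfib x hx).mono fun y hy => ⟨hy.1, hy.2.2⟩
  intro μ x hx y hy hxy
  have := hi hx hy hxy
  simp [← not_lt, Letter.mk_lt_mk, not_lt.2 this]

variable [Nonempty E]

theorem sum_monotone (m : X → Ordinal.{u}) (hm : MonotoneOn m S)
    (hfib : ∀ x ∈ S, Representable E {y ∈ S | m y = m x}) : Representable E S := by
  obtain ⟨e⟩ := ‹Nonempty E›
  refine sum true m (fun _ => e) ?_ fun x hx => (hfib x hx).mono fun y hy => ⟨hy.1, hy.2.1⟩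
  intro μ x hx y hy hxy
  have := hm hx hy hxy
  simp [← not_lt, Letter.mk_lt_mk, not_lt.2 this]

theorem sum_antitone (m : X → Ordinal.{u}) (hm : AntitoneOn m S)
    (hfib : ∀ x ∈ S, Representable E {y ∈ S | m y = m x}) : Representable E S := by
  obtain ⟨e⟩ := ‹Nonempty E›
  refine sum false m (fun _ => e) ?_ fun x hx => (hfib x hx).mono fun y hy => ⟨hy.1, hy.2.1⟩
  intro μ x hx y hy hxy
  have := hm hx hy hxy
  simp [← not_lt, Letter.mk_lt_mk, not_lt.2 this]

theorem split (z : X) (h1 : Representable E {x ∈ S | x ≤ z})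
    (h2 : Representable E {x ∈ S | z < x}) : Representable E S := by
  classical
  refine sum_monotone (fun x => if x ≤ z then 0 else 1) ?_ ?_
  · intro x _ y _ hxy
    by_cases hy : y ≤ z
    · simp [hy, hxy.trans hy]
    · by_cases hx : x ≤ z <;> simp [hy, hx]
  · intro x _
    by_cases hx : x ≤ z
    · refine h1.mono fun y ⟨hy, h⟩ => ⟨hy, ?_⟩
      by_contra hyz
      simp [hx, hyz] at h
    · refine h2.mono fun y ⟨hy, h⟩ => ⟨hy, ?_⟩
      by_contra hyz
      simp [hx, not_lt.1 hyz] at h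

theorem uIcc_trans {a b c : X} (h1 : Representable E (Set.uIcc a b))
    (h2 : Representable E (Set.uIcc b c)) : Representable E (Set.uIcc a c) := by
  refine split b ?_ ?_
  · rcases le_total a c with h | h
    · rw [Set.uIcc_of_le h]
      exact h1.mono fun x hx => Set.Icc_subset_uIcc ⟨hx.1.1, hx.2⟩
    · rw [Set.uIcc_of_ge h]
      exact h2.mono fun x hx => Set.Icc_subset_uIcc' ⟨hx.1.1, hx.2⟩
  · rcases le_total a c with h | h
    · rw [Set.uIcc_of_le h]
      exact h2.mono fun x hx => Set.Icc_subset_uIcc ⟨hx.2.le, hx.1.2⟩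
    · rw [Set.uIcc_of_ge h]
      exact h1.mono fun x hx => Set.Icc_subset_uIcc' ⟨hx.2.le, hx.1.2⟩

/-- Well-order `X` and send each `x` in `S` to the least rank of a point of `S` above it. This map
is monotone on `S`, and each fibre lies below one point. It plays the role of a cofinal sequence. -/
theorem of_Iic (h : ∀ y ∈ S, Representable E {x ∈ S | x ≤ y}) : Representable E S := by
  let rk : X → Ordinal.{u} := Ordinal.typein WellOrderingRel
  have hrk : Function.Injective rk := Ordinal.typein_injective _
  have hmem : ∀ x ∈ S, sInf (rk '' {y ∈ S | x ≤ y}) ∈ rk '' {y ∈ S | x ≤ y} := fun x hx =>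
    csInf_mem ⟨_, x, ⟨hx, le_rfl⟩, rfl⟩
  refine sum_monotone (fun x => sInf (rk '' {y ∈ S | x ≤ y})) ?_ ?_
  · intro x _ y hy hxy
    obtain ⟨z, hz, hzr⟩ := hmem y hy
    exact csInf_le' ⟨z, ⟨hz.1, hxy.trans hz.2⟩, hzr⟩
  · intro x hx
    obtain ⟨z, hz, hzr⟩ := hmem x hx
    refine (h z hz.1).mono fun y ⟨hy, hyx⟩ => ⟨hy, ?_⟩
    obtain ⟨w, hw, hwr⟩ := hmem y hy
    rw [← hrk ((hwr.trans hyx).trans hzr.symm)]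
    exact hw.2

theorem of_Ici (h : ∀ y ∈ S, Representable E {x ∈ S | y ≤ x}) : Representable E S := by
  let rk : X → Ordinal.{u} := Ordinal.typein WellOrderingRel
  have hrk : Function.Injective rk := Ordinal.typein_injective _
  have hmem : ∀ x ∈ S, sInf (rk '' {y ∈ S | y ≤ x}) ∈ rk '' {y ∈ S | y ≤ x} := fun x hx =>
    csInf_mem ⟨_, x, ⟨hx, le_rfl⟩, rfl⟩
  refine sum_antitone (fun x => sInf (rk '' {y ∈ S | y ≤ x})) ?_ ?_
  · intro x hx y _ hxy
    obtain ⟨z, hz, hzr⟩ := hmem x hx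
    exact csInf_le' ⟨z, ⟨hz.1, hz.2.trans hxy⟩, hzr⟩
  · intro x hx
    obtain ⟨z, hz, hzr⟩ := hmem x hx
    refine (h z hz.1).mono fun y ⟨hy, hyx⟩ => ⟨hy, ?_⟩
    obtain ⟨w, hw, hwr⟩ := hmem y hy
    rw [← hrk ((hwr.trans hyx).trans hzr.symm)]
    exact hw.2

theorem of_uIcc (a : X) (h : ∀ x ∈ S, Representable E (Set.uIcc a x)) : Representable E S := by
  refine split a (of_Ici ?_) (of_Iic ?_)
  · rintro y ⟨hy, -⟩
    exact (h y hy).mono fun x hx => Set.Icc_subset_uIcc' ⟨hx.2, hx.1.2⟩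
  · rintro y ⟨hy, -⟩
    exact (h y hy).mono fun x hx => Set.Icc_subset_uIcc ⟨hx.1.2.le, hx.2⟩

end Representable

/-- Hausdorff's theorem: a `κ`-scattered linear order embeds into the descending words below some
ordinal, with indices from an order that embeds all orders of size less than `κ`. -/
theorem ScatteredOn.representable {κ : Cardinal.{u}} (hκ : ℵ₀ ≤ κ)
    (hE : ∀ (I : Type u) [LinearOrder I], #I < κ → ∃ f : I → E, StrictMono f)
    (hX : ScatteredOn κ (Set.univ : Set X)) : Representable E (Set.univ : Set X) := by
  classical
  have : Nonempty E := by
    obtain ⟨f, -⟩ := hE PUnit (by simpa using one_lt_aleph0.trans_le hκ)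
    exact ⟨f ⟨⟩⟩
  -- Condensation: points are identified when the interval between them is representable. If several
  -- classes remain, their representatives form a `κ`-dense suborder.
  let r : Setoid X :=
    { r := fun a b => Representable E (Set.uIcc a b)
      iseqv := ⟨fun a => .of_subsingleton (by simp), fun h => by rwa [Set.uIcc_comm],
        fun h1 h2 => h1.uIcc_trans h2⟩ }
  have hr : ∀ a b, r a b ↔ Representable E (Set.uIcc a b) := fun a b => Iff.rfl
  by_cases hall : ∀ a b, r a b
  · rcases isEmpty_or_nonempty X with hX0 | ⟨⟨a⟩⟩
    · exact .of_subsingleton fun x => hX0.elim x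
    · exact .of_uIcc a fun x _ => hall a x
  push Not at hall
  obtain ⟨a₀, b₀, hab₀⟩ := hall
  let m : X → X := fun x => (Quotient.mk r x).out
  have hmr : ∀ x, r (m x) x := fun x => Quotient.exact (Quotient.out_eq _)
  have hm : ∀ {x y}, r x y → m x = m y := fun h => congrArg Quotient.out (Quotient.sound h)
  have hm' : ∀ {x y}, m x = m y → r x y := fun {x y} h =>
    r.trans (r.symm (hmr x)) (h ▸ hmr y)
  have hmono : Monotone m := by
    intro x y hxy
    by_contra! hlt
    refine hlt.ne (hm ?_).symm
    rcases le_total (m x) y with h | h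
    · have h1 : r (m x) (m y) := r.symm ((hmr y).mono
        (Set.uIcc_subset_uIcc Set.left_mem_uIcc (Set.Icc_subset_uIcc ⟨hlt.le, h⟩)))
      exact r.trans (r.symm (hmr x)) (r.trans h1 (hmr y))
    · exact (r.symm (hmr x)).mono
        (Set.uIcc_subset_uIcc Set.left_mem_uIcc (Set.Icc_subset_uIcc ⟨hxy, h⟩))
  have hmm : ∀ x, m (m x) = m x := fun x => hm (hmr x)
  refine absurd (fun d => Set.mem_univ _) (hX (Set.range m) ⟨?_, ?_⟩ Subtype.val fun _ _ h => h)
  · rw [one_lt_iff_nontrivial]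
    exact ⟨⟨m a₀, a₀, rfl⟩, ⟨m b₀, b₀, rfl⟩, fun h => hab₀ (hm' (congrArg Subtype.val h))⟩
  · intro a b hab
    by_contra! hlt
    have hI : #(Set.Icc a b) < κ := by
      have hsub : Set.Icc a b ⊆ insert a (insert b (Set.Ioo a b)) := by
        intro x hx
        rcases hx.1.eq_or_lt with h | h
        · exact .inl h.symm
        · rcases hx.2.eq_or_lt with h' | h'
          · exact .inr (.inl h')
          · exact .inr (.inr ⟨h, h'⟩)
      refine (mk_le_mk_of_subset hsub).trans_lt ?_
      have h1 : (1 : Cardinal.{u}) < κ := one_lt_aleph0.trans_le hκ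
      exact (mk_insert_le).trans_lt (add_lt_of_lt hκ
        ((mk_insert_le).trans_lt (add_lt_of_lt hκ hlt h1)) h1)
    obtain ⟨ι, hι⟩ := hE _ hI
    have hma : m a.1 = a.1 := by obtain ⟨_, x, rfl⟩ := a; exact hmm x
    have hmb : m b.1 = b.1 := by obtain ⟨_, x, rfl⟩ := b; exact hmm x
    have hmem : ∀ x ∈ Set.Icc a.1 b.1, (⟨m x, x, rfl⟩ : Set.range m) ∈ Set.Icc a b := by
      intro x hx
      exact ⟨hma.symm.le.trans (hmono hx.1), (hmono hx.2).trans hmb.le⟩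
    obtain ⟨e₀⟩ := ‹Nonempty E›
    -- With fewer than `κ` representatives between `a` and `b`, these embed into `E`. The interval
    -- is then a sum along `E` of representable pieces, which forces `a` and `b` to be equivalent.
    let i : X → E := fun x => if h : x ∈ Set.Icc a.1 b.1 then ι ⟨_, hmem x h⟩ else e₀
    have hi : ∀ x (h : x ∈ Set.Icc a.1 b.1), i x = ι ⟨_, hmem x h⟩ := fun x h => dif_pos h
    have hrab : r a.1 b.1 := by
      rw [hr, Set.uIcc_of_le (show a.1 ≤ b.1 from hab.le)]
      have : Nonempty E := ⟨e₀⟩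
      refine .sum_index i ?_ ?_
      · intro x hx y hy hxy
        rw [hi x hx, hi y hy]
        exact hι.monotone (hmono hxy)
      · intro x hx
        refine .of_uIcc x fun y ⟨hy, hyx⟩ => ?_
        rw [hi x hx, hi y hy] at hyx
        exact r.symm (hm' (congrArg (fun z => z.1.1) (hι.injective hyx)))
    exact hab.ne (Subtype.ext (hma.symm.trans ((hm hrab).trans hmb)))

end Representable

/-! ### The square-bracket relation -/

theorem mainTheorem1 (κ : Cardinal.{u}) (hκ : Cardinal.aleph0 ≤ κ)
    (hpow : Cardinal.powerlt κ κ = κ) (φ : OrderType.{u}) (hφ : OrderType.CardScattered κ φ)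
    (ν : Cardinal.{u}) :
    ∃ ψ : OrderType.{u}, OrderType.CardScattered κ ψ ∧ OrderType.SquareBracket ψ φ 1 ν κ := by
  induction ν using Cardinal.inductionOn with | mk N =>
  obtain ⟨E, _, hEκ, hEs, hEu⟩ := exists_scattered_universal hκ hpow
  rw [← OrderType.type_toType φ, OrderType.cardScattered_type_iff] at hφ
  obtain ⟨α, f, hf, hfα⟩ := hφ.representable hκ hEu
  obtain ⟨ρ, hρ⟩ := exists_realizes (E := E) (C := N) α
  let W := {l : List (Letter E) | Desc ρ l}
  refine ⟨OrderType.type (Shrink.{u} W), ?_, ?_⟩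
  · rw [OrderType.cardScattered_type_iff]
    refine (Desc.scatteredOn hκ hEs ρ).of_map (fun x => ((orderIsoShrink W).symm x).1)
      (fun x _ y _ h => (orderIsoShrink W).symm.strictMono h) fun x _ => ?_
    exact ((orderIsoShrink W).symm x).2
  · intro P _ hP C hC F
    obtain ⟨i⟩ := OrderType.type_eq_type.1 hP
    let k : P ≃o W := i.trans (orderIsoShrink W).symm
    obtain ⟨e⟩ : Nonempty (C ≃ N) := Cardinal.eq.1 hC
    let F' : P → C := fun p => F ⟨{p}, Finset.card_singleton p⟩
    have c₀ : C := F' (k.symm ⟨[], trivial⟩)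
    classical
    -- Words outside `W` get the arbitrary colour `e c₀`; the copy found lies in `W`.
    let c : List (Letter E) → N := fun l => if h : l ∈ W then e (F' (k.symm ⟨l, h⟩)) else e c₀
    have hc : ∀ l (h : l ∈ W), c l = e (F' (k.symm ⟨l, h⟩)) := fun l h => dif_pos h
    obtain ⟨g, j, hj, hjc⟩ := hρ c
    let q : φ.ToType → P := fun x => k.symm ⟨j (f x), (hjc _ (hfα x trivial)).1⟩
    have hq : StrictMono q := fun x y h => k.symm.strictMono
      (hj (hfα x trivial) (hfα y trivial) (hf trivial trivial h))
    refine ⟨Set.range (e.symm ∘ g), Set.range q, ?_, ?_, ?_⟩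
    · refine Order.lt_succ_of_le (mk_range_le.trans ((mk_list_le_max _).trans (max_le hκ ?_)))
      rw [mk_prod, lift_uzero]
      exact (mul_le_mul' ((lift_le_aleph0.2 mk_le_aleph0).trans hκ) hEκ).trans (mul_eq_self hκ).le
    · exact (OrderType.type_eq_type.2 ⟨(hq.orderIso q).symm⟩).trans (OrderType.type_toType φ)
    · rintro ⟨s, hs⟩ hsQ
      obtain ⟨p, rfl⟩ := Finset.card_eq_one.1 hs
      obtain ⟨x, rfl⟩ : p ∈ Set.range q := hsQ (by simp)
      have h := hjc _ (hfα x trivial)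
      refine ⟨signWord (f x), ?_⟩
      rw [Function.comp_apply, ← h.2, hc _ h.1, Equiv.symm_apply_apply]
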